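/- Let $\Omega\subset\mathbb{R}^2$ be a bounded domain (a bounded, nonempty, connected open set) and let $\varphi\in C^0(\partial\Omega)$. A solution means a function $u\in C^2(\Omega)\cap C^0(\overline{\Omega})$ with $$\operatorname{div}\left(\frac{Du}{\sqrt{1+|Du|^2}}\right)=\frac{1}{\sqrt{1+|Du|^2}}\ \text{ in }\Omega,\qquad u=\varphi\ \text{ on }\partial\Omega.$$ Then: 1. The solution, if it exists, is unique. 2. There is a constant $C_1=C_1(\varphi,\Omega)$ such that every solution $u$ satisfies $C_1\le u\le \max_{\partial\Omega}\varphi$ in $\Omega$. Moreover, whenever $D$ is an open disc with centre $c$ and $\overline{\Omega}\subset D$, and $\mathbf b\in C^2(D)\cap C^0(\overline D)$ is a bowl soliton over $D$ with zero boundary values (a radially symmetric solution about $c$ of the same equation in $D$ with $\mathbf b=0$ on $\partial D$), every solution $u$ satisfies $\mathbf b(c)+\min_{\partial\Omega}\varphi\le u$ in $\Omega$. 3. If $u$ is a solution of class $C^1(\overline{\Omega})$, that is, $Du$ extends continuously to $\overline{\Omega}$ (the extension being denoted $Du$ again), then $$\sup_{\Omega}|Du|=\max_{\partial\Omega}|Du|.$$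 In particular, both sides are finite. -/

import Mathlib

open Metric Set

/-- The Euclidean plane. -/
abbrev Plane : Type := EuclideanSpace ℝ (Fin 2)

/-- The divergence `∑ᵢ ∂Fᵢ/∂xᵢ` of a planar vector field. -/
noncomputable def divergence (F : Plane → Plane) (x : Plane) : ℝ :=
  ∑ i : Fin 2, (fderiv ℝ F x (EuclideanSpace.single i 1)) i

/-- `u` satisfies the translating soliton equation
`div (Du / √(1 + |Du|²)) = 1 / √(1 + |Du|²)` at the point `x`. -/
def TranslatingSolitonEqAt (u : Plane → ℝ) (x : Plane) : Prop :=
  divergence (fun y => (1 / √(1 + ‖gradient u y‖ ^ 2)) • gradient u y) x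
    = 1 / √(1 + ‖gradient u x‖ ^ 2)

/-- `u ∈ C²(Ω) ∩ C⁰(closure Ω)` solves the Dirichlet problem for the translating soliton
equation in the open set `Ω` with boundary values `φ`. -/
structure IsDirichletSolution (Ω : Set Plane) (φ u : Plane → ℝ) : Prop where
  contDiffOn : ContDiffOn ℝ 2 u Ω
  continuousOn : ContinuousOn u (closure Ω)
  equation : ∀ x ∈ Ω, TranslatingSolitonEqAt u x
  boundary : ∀ x ∈ frontier Ω, u x = φ x

/-- The part below height `0` of a bowl soliton with vertical axis through `c`, cut along the
circle of radius `R`: a rotationally symmetric solution, regular on the axis, in the disc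
of centre `c` and radius `R`, vanishing on the boundary circle. -/
structure IsBowlCap (c : Plane) (R : ℝ) (b : Plane → ℝ) : Prop where
  isSolution : IsDirichletSolution (ball c R) (fun _ => 0) b
  radial : ∃ f : ℝ → ℝ, ∀ x ∈ closedBall c R, b x = f (dist x c)

/-! Multiplied by (1 + |p|²)^(3/2), where p = Du, the equation becomes (1 + |p|²) tr D²u - ⟨p, D²u
p⟩ = 1 + |p|². It is elliptic and involves neither u itself nor the position, so maximum principles
give everything.

By `sub_le_of_frontier_sub_le`, the difference of two solutions is bounded by its boundary values;
this yields uniqueness and the bowl bound. A single solution has no interior maximum, whence the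
upper bound, and the paraboloid |x|²/2 supplies C₁ without presupposing that a bowl exists.

Translates of a solution are solutions, so comparing u with u(· + te) carries a gradient bound
inward from the boundary, without third derivatives of u (`norm_gradient_le_of_frontier`). -/

open Filter Topology

/-! ### Conditions at a local maximum; gradient fields -/

/-- The second order necessary condition at a local maximum, in terms of the derivative of the
gradient field. -/
theorem IsLocalMax.inner_hessian_nonpos {E : Type*} [NormedAddCommGroup E] [InnerProductSpace ℝ E]
    [CompleteSpace E] {f : E → ℝ} {G : E → E} {H : E →L[ℝ] E} {x : E}
    (hmax : IsLocalMax f x) (hf : ∀ᶠ y in 𝓝 x, HasGradientAt f (G y) y)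
    (hG : HasFDerivAt G H x) (v : E) : inner ℝ (H v) v ≤ 0 := by
  by_contra! hpos
  have hline : ∀ t : ℝ, HasDerivAt (fun s : ℝ => x + s • v) v t := fun t => by
    simpa using ((hasDerivAt_id t).smul_const v).const_add x
  have hcont : Tendsto (fun s : ℝ => x + s • v) (𝓝 0) (𝓝 x) := by
    simpa using (hline 0).continuousAt.tendsto
  have hd : ∀ᶠ t : ℝ in 𝓝 0, HasDerivAt (fun s : ℝ => f (x + s • v))
      (inner ℝ (G (x + t • v)) v) t := by
    filter_upwards [hcont.eventually hf] with t ht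
    have := ht.hasFDerivAt.comp_hasDerivAt t (hline t)
    simpa [Function.comp_def] using this
  have hderiv : deriv (fun s : ℝ => f (x + s • v)) =ᶠ[𝓝 0] fun t => inner ℝ (G (x + t • v)) v :=
    hd.mono fun t ht => ht.deriv
  have hG0 : HasDerivAt (fun t : ℝ => G (x + t • v)) (H v) 0 := by
    have h : HasFDerivAt G H (x + (0 : ℝ) • v) := by simpa using hG
    exact h.comp_hasDerivAt 0 (hline 0)
  have hdd : HasDerivAt (fun t : ℝ => inner ℝ (G (x + t • v)) v) (inner ℝ (H v) v) 0 := by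
    simpa using hG0.inner ℝ (hasDerivAt_const (0 : ℝ) v)
  have hdd' : deriv (deriv (fun s : ℝ => f (x + s • v))) 0 = inner ℝ (H v) v := by
    rw [hderiv.deriv_eq]; exact hdd.deriv
  have hmax' : IsLocalMax (fun s : ℝ => f (x + s • v)) 0 := by
    have := hcont.eventually hmax
    simpa [IsLocalMax, IsMaxFilter] using this
  -- If the second derivative were positive, 0 would also be a local minimum; the restriction to the
  -- line would be locally constant, with second derivative zero.
  have hmin : IsLocalMin (fun s : ℝ => f (x + s • v)) 0 :=
    isLocalMin_of_deriv_deriv_pos (by rw [hdd']; exact hpos) hmax'.deriv_eq_zero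
      hd.self_of_nhds.continuousAt
  have hconst : (fun s : ℝ => f (x + s • v)) =ᶠ[𝓝 0] fun _ => f (x + (0 : ℝ) • v) := by
    filter_upwards [hmax', hmin] with t h1 h2
    exact le_antisymm h1 h2
  have h0 : deriv (deriv (fun s : ℝ => f (x + s • v))) 0 = 0 := by
    rw [hconst.deriv.deriv_eq]; simp
  rw [hdd'] at h0
  exact hpos.ne' h0

theorem IsLocalMax.hasGradientAt_eq_zero {E : Type*} [NormedAddCommGroup E]
    [InnerProductSpace ℝ E] [CompleteSpace E] {f : E → ℝ} {g x : E}
    (hmax : IsLocalMax f x) (hf : HasGradientAt f g x) : g = 0 := by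
  have := hmax.hasFDerivAt_eq_zero hf.hasFDerivAt
  simpa using this

section Gradient

variable {E : Type*} [NormedAddCommGroup E] [InnerProductSpace ℝ E] [CompleteSpace E]
  {u : E → ℝ} {s : Set E} {x : E}

theorem ContDiffOn.gradient_of_isOpen (hu : ContDiffOn ℝ 2 u s) (hs : IsOpen s) :
    ContDiffOn ℝ 1 (gradient u) s :=
  (InnerProductSpace.toDual ℝ E).symm.toContinuousLinearEquiv.contDiff.comp_contDiffOn
    (hu.fderiv_of_isOpen hs (by norm_num))

theorem ContDiffOn.hasGradientAt_of_isOpen (hu : ContDiffOn ℝ 2 u s) (hs : IsOpen s)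
    (hx : x ∈ s) : HasGradientAt u (gradient u x) x :=
  ((hu.contDiffAt (hs.mem_nhds hx)).differentiableAt (by norm_num)).hasGradientAt

theorem ContDiffOn.eventually_hasGradientAt (hu : ContDiffOn ℝ 2 u s) (hs : IsOpen s)
    (hx : x ∈ s) : ∀ᶠ y in 𝓝 x, HasGradientAt u (gradient u y) y :=
  (hs.eventually_mem hx).mono fun _ hy => hu.hasGradientAt_of_isOpen hs hy

theorem ContDiffOn.hasFDerivAt_gradient (hu : ContDiffOn ℝ 2 u s) (hs : IsOpen s)
    (hx : x ∈ s) : HasFDerivAt (gradient u) (fderiv ℝ (gradient u) x) x :=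
  (((hu.gradient_of_isOpen hs).contDiffAt (hs.mem_nhds hx)).differentiableAt
    (by norm_num)).hasFDerivAt

theorem gradient_comp_add_right (u : E → ℝ) (a : E) :
    gradient (fun y => u (y + a)) = fun y => gradient u (y + a) := by
  funext y
  simp [gradient, fderiv_comp_add_right]

end Gradient

/-! ### Nondivergence form of the equation -/

/-- The rotation by a right angle. -/
noncomputable def quarterTurn (p : Plane) : Plane := !₂[-p 1, p 0]

theorem norm_quarterTurn (p : Plane) : ‖quarterTurn p‖ = ‖p‖ := by
  simp [EuclideanSpace.norm_eq, quarterTurn, Fin.sum_univ_two, add_comm]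

theorem quarterTurn_sub (p q : Plane) :
    quarterTurn (p - q) = quarterTurn p - quarterTurn q := by
  ext i; fin_cases i <;> simp [quarterTurn]; ring

/-- The principal part `(1 + |p|²) tr H - ⟨p, H p⟩` of the equation for gradient `p` and Hessian
`H`, written as a sum of values of the quadratic form of `H`. -/
noncomputable def principalPart (p : Plane) (H : Plane →L[ℝ] Plane) : ℝ :=
  inner ℝ (H (EuclideanSpace.single 0 1)) (EuclideanSpace.single 0 1)
    + inner ℝ (H (EuclideanSpace.single 1 1)) (EuclideanSpace.single 1 1)
    + inner ℝ (H (quarterTurn p)) (quarterTurn p)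

/-- This is ellipticity. It needs no symmetry of `H` and no diagonalisation, since every summand is
a value of the quadratic form. -/
theorem principalPart_mono {p : Plane} {H K : Plane →L[ℝ] Plane}
    (h : ∀ v, inner ℝ (H v) v ≤ inner ℝ (K v) v) : principalPart p H ≤ principalPart p K :=
  add_le_add (add_le_add (h _) (h _)) (h _)

theorem apply_eq_coord (H : Plane →L[ℝ] Plane) (v : Plane) :
    H v = v 0 • H (EuclideanSpace.single 0 1) + v 1 • H (EuclideanSpace.single 1 1) := by
  have : v = v 0 • EuclideanSpace.single 0 (1 : ℝ) + v 1 • EuclideanSpace.single 1 (1 : ℝ) := by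
    ext i; fin_cases i <;> simp
  conv_lhs => rw [this]
  simp

/-- In the plane `p` and `quarterTurn p` are orthogonal of equal length, so their quadratic form
values add up to |p|² tr H. -/
theorem principalPart_eq (p : Plane) (H : Plane →L[ℝ] Plane) :
    principalPart p H = (1 + ‖p‖ ^ 2) * ∑ i : Fin 2, (H (EuclideanSpace.single i 1)) i
      - inner ℝ p (H p) := by
  rw [principalPart, apply_eq_coord H (quarterTurn p), apply_eq_coord H p,
    EuclideanSpace.norm_sq_eq]
  simp [quarterTurn, PiLp.inner_apply, Fin.sum_univ_two]
  ring

theorem divergence_normalized {G : Plane → Plane} {H : Plane →L[ℝ] Plane} {x : Plane}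
    (hG : HasFDerivAt G H x) :
    divergence (fun y => (1 / √(1 + ‖G y‖ ^ 2)) • G y) x
      = principalPart (G x) H / √(1 + ‖G x‖ ^ 2) ^ 3 := by
  have hpos : 0 < 1 + ‖G x‖ ^ 2 := by positivity
  have hW : HasFDerivAt (fun y => 1 / √(1 + ‖G y‖ ^ 2))
      (-(1 / √(1 + ‖G x‖ ^ 2) ^ 3) • (innerSL ℝ (G x)).comp H) x := by
    have h1 : HasFDerivAt (fun y => 1 + ‖G y‖ ^ 2) (2 • (innerSL ℝ (G x)).comp H) x :=
      hG.norm_sq.const_add 1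
    have h2 : HasDerivAt (fun r : ℝ => 1 / √r) (-(1 / (2 * √(1 + ‖G x‖ ^ 2) ^ 3)))
        (1 + ‖G x‖ ^ 2) := by
      have h := (Real.hasDerivAt_sqrt hpos.ne').fun_inv (Real.sqrt_pos.2 hpos).ne'
      simp only [← one_div] at h
      refine h.congr_deriv ?_
      have := (Real.sqrt_pos.2 hpos).ne'
      field_simp
    have h3 := h2.comp_hasFDerivAt x h1
    refine h3.congr_fderiv ?_
    ext v
    simp
    ring
  have hF : HasFDerivAt (fun y => (1 / √(1 + ‖G y‖ ^ 2)) • G y) _ x := hW.smul hG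
  have hs := Real.sq_sqrt hpos.le
  have hs0 := (Real.sqrt_pos.2 hpos).ne'
  rw [divergence, hF.fderiv, principalPart_eq, apply_eq_coord H (G x)]
  generalize √(1 + ‖G x‖ ^ 2) = W at *
  rw [← hs]
  simp [Fin.sum_univ_two, PiLp.inner_apply]
  field_simp
  ring

theorem translatingSolitonEqAt_iff {u : Plane → ℝ} {x : Plane} {H : Plane →L[ℝ] Plane}
    (hu : HasFDerivAt (gradient u) H x) :
    TranslatingSolitonEqAt u x ↔ principalPart (gradient u x) H = 1 + ‖gradient u x‖ ^ 2 := by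
  have hpos : 0 < 1 + ‖gradient u x‖ ^ 2 := by positivity
  have hs := Real.sq_sqrt hpos.le
  have hs0 := (Real.sqrt_pos.2 hpos).ne'
  rw [TranslatingSolitonEqAt, divergence_normalized hu]
  generalize √(1 + ‖gradient u x‖ ^ 2) = W at *
  rw [← hs]
  field_simp

theorem TranslatingSolitonEqAt.comp_add_right {u : Plane → ℝ} {x a : Plane}
    (h : TranslatingSolitonEqAt u (x + a)) :
    TranslatingSolitonEqAt (fun y => u (y + a)) x := by
  rw [TranslatingSolitonEqAt, divergence] at h ⊢
  rw [gradient_comp_add_right]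
  rw [fderiv_comp_add_right (f := fun y => (1 / √(1 + ‖gradient u y‖ ^ 2)) • gradient u y)]
  exact h

/-- The dependence on the gradient is quadratic, so the difference telescopes into two terms linear
in `p - q`. -/
theorem principalPart_sub_le (p q : Plane) (K : Plane →L[ℝ] Plane) :
    principalPart p K - principalPart q K ≤ ‖K‖ * (‖p‖ + ‖q‖) * ‖p - q‖ := by
  have h : principalPart p K - principalPart q K
      = inner ℝ (K (quarterTurn (p - q))) (quarterTurn p)
        + inner ℝ (K (quarterTurn q)) (quarterTurn (p - q)) := by
    simp only [principalPart, quarterTurn_sub, map_sub, inner_sub_left, inner_sub_right]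
    ring
  have key : ∀ a b : Plane, inner ℝ (K a) b ≤ ‖K‖ * ‖a‖ * ‖b‖ := fun a b =>
    (real_inner_le_norm _ _).trans (by gcongr; exact K.le_opNorm a)
  have h1 := key (quarterTurn (p - q)) (quarterTurn p)
  have h2 := key (quarterTurn q) (quarterTurn (p - q))
  simp only [norm_quarterTurn] at h1 h2
  rw [h]
  linarith

/-! ### Exponential perturbation and the comparison principle -/

/-- The rank one Hessian of a function of the first coordinate. -/
noncomputable def firstCoordForm : Plane →L[ℝ] Plane :=
  (innerSL ℝ (EuclideanSpace.single 0 (1 : ℝ) : Plane)).smulRight (EuclideanSpace.single 0 1)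

theorem one_le_principalPart_firstCoordForm (p : Plane) :
    1 ≤ principalPart p firstCoordForm := by
  simp [principalPart, firstCoordForm, inner_smul_left]
  rw [add_assoc, le_add_iff_nonneg_right]
  exact add_nonneg (mul_self_nonneg _) (mul_self_nonneg _)

theorem principalPart_sub_smul (p : Plane) (K L : Plane →L[ℝ] Plane) (c : ℝ) :
    principalPart p (K - c • L) = principalPart p K - c * principalPart p L := by
  simp [principalPart, inner_sub_left, inner_smul_left]
  ring

theorem hasGradientAt_exp_firstCoord (γ : ℝ) (y : Plane) :
    HasGradientAt (fun y : Plane => Real.exp (γ * y 0))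
      ((γ * Real.exp (γ * y 0)) • (EuclideanSpace.single 0 1 : Plane)) y := by
  rw [hasGradientAt_iff_hasFDerivAt]
  have h : HasFDerivAt (fun y : Plane => y 0) (EuclideanSpace.proj (𝕜 := ℝ) (0 : Fin 2)) y :=
    (EuclideanSpace.proj (𝕜 := ℝ) (0 : Fin 2) : Plane →L[ℝ] ℝ).hasFDerivAt
  refine ((h.const_mul γ).exp).congr_fderiv ?_
  ext v
  simp [EuclideanSpace.inner_single_left]
  ring

theorem hasFDerivAt_gradient_exp_firstCoord (γ : ℝ) (y : Plane) :
    HasFDerivAt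
      (fun y : Plane => (γ * Real.exp (γ * y 0)) • (EuclideanSpace.single 0 1 : Plane))
      ((γ * (γ * Real.exp (γ * y 0))) • firstCoordForm) y := by
  have h := (((hasGradientAt_exp_firstCoord γ y).hasFDerivAt.const_mul γ).smul_const
    (EuclideanSpace.single 0 1 : Plane))
  refine h.congr_fderiv ?_
  ext v i
  simp [firstCoordForm]
  ring_nf

theorem IsLocalMax.principalPart_le {u v : Plane → ℝ} {G₁ G₂ : Plane → Plane}
    {H K : Plane →L[ℝ] Plane} {x : Plane}
    (hmax : IsLocalMax (fun y => u y - v y) x)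
    (hu : ∀ᶠ y in 𝓝 x, HasGradientAt u (G₁ y) y) (hv : ∀ᶠ y in 𝓝 x, HasGradientAt v (G₂ y) y)
    (hH : HasFDerivAt G₁ H x) (hK : HasFDerivAt G₂ K x) :
    G₁ x = G₂ x ∧ ∀ p, principalPart p H ≤ principalPart p K := by
  have hsub : ∀ᶠ y in 𝓝 x, HasGradientAt (fun y => u y - v y) (G₁ y - G₂ y) y := by
    filter_upwards [hu, hv] with y h1 h2
    rw [hasGradientAt_iff_hasFDerivAt] at *
    rw [map_sub]
    exact h1.sub h2
  refine ⟨sub_eq_zero.1 (hmax.hasGradientAt_eq_zero hsub.self_of_nhds), fun p => ?_⟩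
  refine principalPart_mono fun w => ?_
  have := hmax.inner_hessian_nonpos hsub (hH.sub hK) w
  rw [sub_apply, inner_sub_left] at this
  linarith

/-- At an interior maximum of `u - v + ε exp (γ x₀)`, where `u` and `v` solve the equation, the
exponent `γ` is controlled by the derivatives of `u` and `v`. -/
theorem exponent_le_of_isLocalMax {U : Set Plane} (hU : IsOpen U) {u v : Plane → ℝ}
    (hu : ContDiffOn ℝ 2 u U) (hv : ContDiffOn ℝ 2 v U) {x : Plane} (hx : x ∈ U)
    (hequ : TranslatingSolitonEqAt u x) (heqv : TranslatingSolitonEqAt v x)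
    {B γ ε : ℝ} (hγ : 0 < γ) (hε : 0 < ε)
    (hBu : ‖gradient u x‖ ≤ B) (hBv : ‖gradient v x‖ ≤ B)
    (hBH : ‖fderiv ℝ (gradient v) x‖ ≤ B)
    (hmax : IsLocalMax (fun y => u y - v y + ε * Real.exp (γ * y 0)) x) :
    γ ≤ 2 * B * (B + 1) := by
  rw [translatingSolitonEqAt_iff (hu.hasFDerivAt_gradient hU hx)] at hequ
  rw [translatingSolitonEqAt_iff (hv.hasFDerivAt_gradient hU hx)] at heqv
  have hmax' : IsLocalMax (fun y => u y - (v y - ε * Real.exp (γ * y 0))) x := by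
    convert hmax using 2
    ring
  obtain ⟨hgrad, hle⟩ := hmax'.principalPart_le (hu.eventually_hasGradientAt hU hx)
    (G₂ := fun y => gradient v y
      - ε • ((γ * Real.exp (γ * y 0)) • (EuclideanSpace.single 0 1 : Plane)))
    ((hv.eventually_hasGradientAt hU hx).mono fun y hy => by
      have h2 := (hasGradientAt_exp_firstCoord γ y).hasFDerivAt.const_mul ε
      rw [hasGradientAt_iff_hasFDerivAt] at *
      refine (hy.sub h2).congr_fderiv ?_
      simp only [map_sub, map_smulₛₗ]
      simp)
    (hu.hasFDerivAt_gradient hU hx)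
    ((hv.hasFDerivAt_gradient hU hx).sub
      ((hasFDerivAt_gradient_exp_firstCoord γ x).const_smul ε))
  have hle := hle (gradient u x)
  have hB : 0 ≤ B := (norm_nonneg _).trans hBu
  have hsub := principalPart_sub_le (gradient u x) (gradient v x) (fderiv ℝ (gradient v) x)
  have hone := one_le_principalPart_firstCoordForm (gradient u x)
  rw [hequ, smul_smul, principalPart_sub_smul] at hle
  rw [heqv] at hsub
  -- This gradient gap d measures all terms: the errors are at most 2B(B + 1)d, while the
  -- exponential contributes at least γd. Dividing by d removes ε.
  have hd : ‖gradient u x - gradient v x‖ = ε * (γ * Real.exp (γ * x 0)) := by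
    rw [hgrad, sub_sub_cancel_left, norm_neg, smul_smul, norm_smul]
    simp only [PiLp.norm_single, norm_one, mul_one]
    exact Real.norm_of_nonneg (by positivity)
  have hdpos : 0 < ‖gradient u x - gradient v x‖ := by rw [hd]; positivity
  have hsq : ‖gradient v x‖ ^ 2 - ‖gradient u x‖ ^ 2
      ≤ (2 * B) * ‖gradient u x - gradient v x‖ := by
    have h1 : ‖gradient v x‖ - ‖gradient u x‖ ≤ ‖gradient u x - gradient v x‖ := by
      rw [norm_sub_rev]; exact norm_sub_norm_le _ _
    nlinarith [norm_nonneg (gradient v x), norm_nonneg (gradient u x)]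
  have hprod : ‖fderiv ℝ (gradient v) x‖ * (‖gradient u x‖ + ‖gradient v x‖)
      ≤ B * (B + B) := by gcongr
  have hprod' := mul_le_mul_of_nonneg_right hprod hdpos.le
  have hc : γ * ‖gradient u x - gradient v x‖
      ≤ ε * (γ * (γ * Real.exp (γ * x 0))) * principalPart (gradient u x) firstCoordForm := by
    rw [hd]
    calc γ * (ε * (γ * Real.exp (γ * x 0)))
        = ε * (γ * (γ * Real.exp (γ * x 0))) * 1 := by ring
      _ ≤ _ := by gcongr
  refine le_of_mul_le_mul_right ?_ hdpos
  linarith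

/-- The comparison principle for the translating soliton equation. -/
theorem sub_le_of_frontier_sub_le {U : Set Plane} (hU : IsOpen U) (hUb : Bornology.IsBounded U)
    {u v : Plane → ℝ} (hu : ContDiffOn ℝ 2 u U) (hv : ContDiffOn ℝ 2 v U)
    (huc : ContinuousOn u (closure U)) (hvc : ContinuousOn v (closure U))
    (hequ : ∀ x ∈ U, TranslatingSolitonEqAt u x) (heqv : ∀ x ∈ U, TranslatingSolitonEqAt v x)
    {k : ℝ} (hk : ∀ x ∈ frontier U, u x - v x ≤ k) {x : Plane} (hx : x ∈ U) :
    u x - v x ≤ k := by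
  by_contra! hlt
  have hcomp : IsCompact (closure U) := hUb.isCompact_closure
  have hwc : ContinuousOn (fun y => u y - v y) (closure U) := huc.sub hvc
  obtain ⟨m, hkm, hmx⟩ := exists_between hlt
  -- Derivatives may blow up at the boundary, but they are bounded on this compact subset of `U`,
  -- independently of γ and ε.
  have hKcomp : IsCompact {y ∈ closure U | m ≤ u y - v y} :=
    hcomp.of_isClosed_subset
      (hwc.preimage_isClosed_of_isClosed isClosed_closure (isClosed_Ici (a := m)))
      fun y hy => hy.1
  have hKU : {y ∈ closure U | m ≤ u y - v y} ⊆ U := by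
    rintro y ⟨hyc, hym⟩
    by_contra hyU
    have := hk y ⟨hyc, by rwa [hU.interior_eq]⟩
    linarith
  obtain ⟨B₁, hB₁⟩ := hKcomp.exists_bound_of_continuousOn
    ((hu.gradient_of_isOpen hU).continuousOn.mono hKU)
  obtain ⟨B₂, hB₂⟩ := hKcomp.exists_bound_of_continuousOn
    ((hv.gradient_of_isOpen hU).continuousOn.mono hKU)
  obtain ⟨B₃, hB₃⟩ := hKcomp.exists_bound_of_continuousOn
    (((hv.gradient_of_isOpen hU).continuousOn_fderiv_of_isOpen hU le_rfl).mono hKU)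
  set B := max 0 (max B₁ (max B₂ B₃)) with hBdef
  have hB0 : 0 ≤ B := le_max_left _ _
  set γ := 2 * B * (B + 1) + 1 with hγdef
  have hγ : 0 < γ := by positivity
  have hexpc : Continuous fun y : Plane => Real.exp (γ * y 0) := by fun_prop
  obtain ⟨S, hS⟩ := hcomp.exists_bound_of_continuousOn hexpc.continuousOn
  have hSpos : 0 < S := (norm_pos_iff.2 (Real.exp_pos _).ne').trans_le (hS x (subset_closure hx))
  -- So small that the perturbed maximum still lies where `u - v ≥ m`.
  set ε := (u x - v x - m) / S with hεdef
  have hε : 0 < ε := div_pos (by linarith) hSpos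
  obtain ⟨z, hz, hzmax⟩ := hcomp.exists_isMaxOn ⟨x, subset_closure hx⟩
    (hwc.add (hexpc.continuousOn.const_smul ε))
  have hzK : z ∈ {y ∈ closure U | m ≤ u y - v y} := by
    refine ⟨hz, ?_⟩
    have h1 : u x - v x + ε * Real.exp (γ * x 0) ≤ u z - v z + ε * Real.exp (γ * z 0) :=
      hzmax (subset_closure hx)
    have h2 : ε * Real.exp (γ * z 0) ≤ ε * S :=
      mul_le_mul_of_nonneg_left ((le_abs_self _).trans (hS z hz)) hε.le
    have h3 : ε * S = u x - v x - m := div_mul_cancel₀ _ hSpos.ne'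
    have h4 : 0 < ε * Real.exp (γ * x 0) := by positivity
    linarith
  have hzU := hKU hzK
  have hlocal : IsLocalMax (fun y => u y - v y + ε * Real.exp (γ * y 0)) z :=
    hzmax.isLocalMax (mem_of_superset (hU.mem_nhds hzU) subset_closure)
  have hle := exponent_le_of_isLocalMax hU hu hv hzU (hequ z hzU) (heqv z hzU) (B := B) hγ hε
    ((hB₁ z hzK).trans (by simp [hBdef])) ((hB₂ z hzK).trans (by simp [hBdef]))
    ((hB₃ z hzK).trans (by simp [hBdef])) hlocal
  linarith

/-! ### Maximum principles for a single solution -/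

/-- A function without interior local maxima is bounded on a bounded open set by its values on
the boundary. -/
theorem le_of_frontier_le_of_not_isLocalMax {U : Set Plane} (hU : IsOpen U)
    (hUb : Bornology.IsBounded U) {w : Plane → ℝ} (hw : ContinuousOn w (closure U))
    (hloc : ∀ x ∈ U, ¬ IsLocalMax w x) {k : ℝ} (hk : ∀ x ∈ frontier U, w x ≤ k)
    {x : Plane} (hx : x ∈ U) : w x ≤ k := by
  obtain ⟨z, hz, hzmax⟩ := hUb.isCompact_closure.exists_isMaxOn ⟨x, subset_closure hx⟩ hw
  have hzU : z ∉ U := fun h => hloc z h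
    (hzmax.isLocalMax (mem_of_superset (hU.mem_nhds h) subset_closure))
  exact (hzmax (subset_closure hx)).trans (hk z ⟨hz, by rwa [hU.interior_eq]⟩)

/-- At a maximum the principal part would be nonpositive, but the equation makes it at least 1. -/
theorem not_isLocalMax_of_translatingSolitonEqAt {U : Set Plane} (hU : IsOpen U) {u : Plane → ℝ}
    (hu : ContDiffOn ℝ 2 u U) {x : Plane} (hx : x ∈ U) (heq : TranslatingSolitonEqAt u x) :
    ¬ IsLocalMax u x := by
  intro hmax
  rw [translatingSolitonEqAt_iff (hu.hasFDerivAt_gradient hU hx)] at heq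
  have hmax' : IsLocalMax (fun y => u y - (fun _ => (0 : ℝ)) y) x := by simpa using hmax
  obtain ⟨-, hle⟩ := hmax'.principalPart_le (hu.eventually_hasGradientAt hU hx)
    (Eventually.of_forall fun y => hasGradientAt_const y 0) (hu.hasFDerivAt_gradient hU hx)
    (hasFDerivAt_const (0 : Plane) x)
  have hle := hle (gradient u x)
  rw [heq] at hle
  simp [principalPart] at hle
  nlinarith [norm_nonneg (gradient u x)]

/-- The paraboloid `|x|² / 2` is a strict subsolution. -/
theorem not_isLocalMax_paraboloid_sub {U : Set Plane} (hU : IsOpen U) {u : Plane → ℝ}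
    (hu : ContDiffOn ℝ 2 u U) {x : Plane} (hx : x ∈ U) (heq : TranslatingSolitonEqAt u x) :
    ¬ IsLocalMax (fun y => (1 / 2 : ℝ) * ‖y‖ ^ 2 - u y) x := by
  intro hmax
  rw [translatingSolitonEqAt_iff (hu.hasFDerivAt_gradient hU hx)] at heq
  obtain ⟨hgrad, hle⟩ := hmax.principalPart_le (G₁ := fun y => y)
    (Eventually.of_forall fun y => by
      rw [hasGradientAt_iff_hasFDerivAt]
      refine (((hasFDerivAt_id y).norm_sq).const_mul (1 / 2)).congr_fderiv ?_
      ext v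
      simp)
    (hu.eventually_hasGradientAt hU hx)
    (hasFDerivAt_id x) (hu.hasFDerivAt_gradient hU hx)
  have hle := hle (gradient u x)
  rw [heq] at hle
  -- The identity Hessian has principal part 2 + |p|², exceeding the 1 + |p|² of a solution.
  simp [principalPart, norm_quarterTurn] at hle
  linarith

/-! ### Gradient estimate by translation -/

/-- The maximum principle for the gradient: it is bounded by the boundary values of its
continuous extension. -/
theorem norm_gradient_le_of_frontier {Ω : Set Plane} (hΩ : IsOpen Ω)
    (hΩb : Bornology.IsBounded Ω) {u : Plane → ℝ} (hu : ContDiffOn ℝ 2 u Ω)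
    (heq : ∀ x ∈ Ω, TranslatingSolitonEqAt u x) {G : Plane → Plane}
    (hGc : ContinuousOn G (closure Ω)) (hG : ∀ x ∈ Ω, G x = gradient u x) {M : ℝ} (hM : 0 ≤ M)
    (hGM : ∀ x ∈ frontier Ω, ‖G x‖ ≤ M) {x : Plane} (hx : x ∈ Ω) : ‖gradient u x‖ ≤ M := by
  by_contra! hlt
  -- Two levels M < N < N' < |Du(x)|: N > M keeps `closure U` off `frontier Ω`, and N' > N leaves
  -- room for |Du| < N' on a neighbourhood of `frontier U`.
  obtain ⟨N, hMN, hNx⟩ := exists_between hlt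
  obtain ⟨N', hNN', hN'x⟩ := exists_between hNx
  have hgc : ContinuousOn (fun y => ‖gradient u y‖) Ω :=
    (hu.gradient_of_isOpen hΩ).continuousOn.norm
  -- the superlevel set `U` of the gradient is compactly contained in `Ω`
  set U : Set Plane := Ω ∩ (fun y => ‖gradient u y‖) ⁻¹' Ioi N with hUdef
  have hU : IsOpen U := hgc.isOpen_inter_preimage hΩ isOpen_Ioi
  have hUΩ : U ⊆ Ω := inter_subset_left
  have hUb : Bornology.IsBounded U := hΩb.subset hUΩ
  have hclU : closure U ⊆ Ω := by
    have hclosed : IsClosed (closure Ω ∩ (fun y => ‖G y‖) ⁻¹' Ici N) :=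
      hGc.norm.preimage_isClosed_of_isClosed isClosed_closure isClosed_Ici
    have hsub : closure U ⊆ closure Ω ∩ (fun y => ‖G y‖) ⁻¹' Ici N :=
      closure_minimal (fun y hy => ⟨subset_closure hy.1, by
        have := hy.2
        simp only [mem_preimage, mem_Ioi] at this
        simpa [hG y hy.1] using this.le⟩) hclosed
    intro y hy
    by_contra hyΩ
    have h1 := hGM y ⟨(hsub hy).1, by rwa [hΩ.interior_eq]⟩
    have h2 : N ≤ ‖G y‖ := (hsub hy).2
    linarith
  have hfr : frontier U ⊆ Ω ∩ (fun y => ‖gradient u y‖) ⁻¹' Iio N' := by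
    intro y hy
    have hyΩ := hclU hy.1
    refine ⟨hyΩ, ?_⟩
    by_contra hle
    simp only [mem_preimage, mem_Iio, not_lt] at hle
    exact hy.2 (by rw [hU.interior_eq]; exact ⟨hyΩ, hNN'.trans_le hle⟩)
  obtain ⟨δ₁, hδ₁, hδ₁Ω⟩ := hUb.isCompact_closure.exists_cthickening_subset_open hΩ hclU
  obtain ⟨δ₂, hδ₂, hδ₂V⟩ := (hUb.isCompact_closure.of_isClosed_subset isClosed_frontier
    frontier_subset_closure).exists_cthickening_subset_open
      (hgc.isOpen_inter_preimage hΩ isOpen_Iio) hfr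
  have hxU : x ∈ U := ⟨hx, hNx⟩
  set e : Plane := (‖gradient u x‖)⁻¹ • gradient u x with hedef
  have hgpos : 0 < ‖gradient u x‖ := hM.trans_lt hlt
  have he : ‖e‖ = 1 := by
    rw [hedef, norm_smul, norm_inv, norm_norm, inv_mul_cancel₀ hgpos.ne']
  -- comparison of `u` with its translate by `t • e`
  have hcompare : ∀ t : ℝ, 0 < t → t ≤ δ₁ → t ≤ δ₂ → u (x + t • e) - u x ≤ N' * t := by
    intro t ht0 ht1 ht2
    have hnorm : ‖t • e‖ = t := by rw [norm_smul, he, mul_one, Real.norm_of_nonneg ht0.le]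
    have hmaps : ∀ y ∈ closure U, y + t • e ∈ Ω := fun y hy =>
      hδ₁Ω (mem_cthickening_of_dist_le _ y _ _ hy (by simpa [hnorm] using ht1))
    have hv : ContDiffOn ℝ 2 (fun y => u (y + t • e)) (closure U) :=
      hu.comp (contDiff_id.add contDiff_const).contDiffOn hmaps
    refine sub_le_of_frontier_sub_le hU hUb (hv.mono subset_closure) (hu.mono hUΩ)
      hv.continuousOn (hu.continuousOn.mono hclU)
      (fun y hy => (heq _ (hmaps y (subset_closure hy))).comp_add_right)
      (fun y hy => heq y (hUΩ hy)) (fun z hz => ?_) hxU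
    -- The whole disc about the boundary point `z` has |Du| < N', so the mean value inequality
    -- bounds the increment by N't.
    have hball : closedBall z t ⊆ Ω ∩ (fun y => ‖gradient u y‖) ⁻¹' Iio N' := fun y hy =>
      hδ₂V (mem_cthickening_of_dist_le y z _ _ hz ((mem_closedBall.1 hy).trans ht2))
    have := (convex_closedBall z t).norm_image_sub_le_of_norm_fderiv_le (𝕜 := ℝ) (f := u) (C := N')
      (fun y hy => (hu.hasGradientAt_of_isOpen hΩ (hball hy).1).differentiableAt)
      (fun y hy => by
        have h : ‖gradient u y‖ < N' := (hball hy).2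
        simpa [gradient] using h.le)
      (mem_closedBall_self ht0.le) (y := z + t • e) (by simp [hnorm])
    rw [add_sub_cancel_left, hnorm] at this
    exact (le_abs_self _).trans this
  have hderiv : HasDerivAt (fun t : ℝ => u (x + t • e)) ‖gradient u x‖ 0 := by
    have hline : HasDerivAt (fun s : ℝ => x + s • e) e 0 := by
      simpa using ((hasDerivAt_id (0 : ℝ)).smul_const e).const_add x
    have hgrad : HasFDerivAt u (InnerProductSpace.toDual ℝ Plane (gradient u x))
        (x + (0 : ℝ) • e) := by
      simpa using (hu.hasGradientAt_of_isOpen hΩ hx).hasFDerivAt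
    refine (hgrad.comp_hasDerivAt 0 hline).congr_deriv ?_
    rw [InnerProductSpace.toDual_apply_apply, hedef, inner_smul_right,
      real_inner_self_eq_norm_sq]
    field_simp
  have hslope := hderiv.tendsto_slope_zero_right
  have hle : ‖gradient u x‖ ≤ N' := by
    refine le_of_tendsto hslope ?_
    filter_upwards [Ioc_mem_nhdsGT (lt_min hδ₁ hδ₂)] with t ht
    have := hcompare t ht.1 (ht.2.trans (min_le_left _ _)) (ht.2.trans (min_le_right _ _))
    simp only [zero_add, zero_smul, add_zero, smul_eq_mul]
    rw [inv_mul_le_iff₀ ht.1]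
    linarith
  linarith

/-! ### Dirichlet solutions, bowl caps and the final assembly -/

theorem frontier_nonempty_of_isBounded {Ω : Set Plane} (hne : Ω.Nonempty)
    (hb : Bornology.IsBounded Ω) : (frontier Ω).Nonempty := by
  rw [nonempty_frontier_iff]
  exact ⟨hne, fun h => NormedSpace.unbounded_univ ℝ Plane (h ▸ hb)⟩

namespace IsDirichletSolution

variable {Ω : Set Plane} {φ u v : Plane → ℝ}

theorem le_of_frontier_le (hu : IsDirichletSolution Ω φ u) (hΩ : IsOpen Ω)
    (hΩb : Bornology.IsBounded Ω) {k : ℝ} (hk : ∀ x ∈ frontier Ω, φ x ≤ k) {x : Plane}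
    (hx : x ∈ Ω) : u x ≤ k :=
  le_of_frontier_le_of_not_isLocalMax hΩ hΩb hu.continuousOn
    (fun y hy => not_isLocalMax_of_translatingSolitonEqAt hΩ hu.contDiffOn hy (hu.equation y hy))
    (fun y hy => (hu.boundary y hy).trans_le (hk y hy)) hx

theorem sub_le (hu : IsDirichletSolution Ω φ u) (hΩ : IsOpen Ω)
    (hΩb : Bornology.IsBounded Ω) {r m : ℝ} (hr : ∀ x ∈ frontier Ω, ‖x‖ ≤ r)
    (hm : ∀ x ∈ frontier Ω, m ≤ φ x) {x : Plane} (hx : x ∈ Ω) : m - 1 / 2 * r ^ 2 ≤ u x := by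
  have h := le_of_frontier_le_of_not_isLocalMax hΩ hΩb
    (w := fun y => (1 / 2 : ℝ) * ‖y‖ ^ 2 - u y) (k := 1 / 2 * r ^ 2 - m)
    ((by fun_prop : Continuous fun y : Plane => (1 / 2 : ℝ) * ‖y‖ ^ 2).continuousOn.sub
      hu.continuousOn)
    (fun y hy => not_isLocalMax_paraboloid_sub hΩ hu.contDiffOn hy (hu.equation y hy))
    (fun y hy => by
      have h1 := hm y hy
      have h2 : ‖y‖ ^ 2 ≤ r ^ 2 := pow_le_pow_left₀ (norm_nonneg y) (hr y hy) 2
      rw [hu.boundary y hy]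
      linarith) hx
  have := sq_nonneg ‖x‖
  linarith

theorem mono (hu : IsDirichletSolution Ω φ u) {U : Set Plane} (hU : U ⊆ Ω) :
    IsDirichletSolution U u u where
  contDiffOn := hu.contDiffOn.mono hU
  continuousOn := hu.continuousOn.mono (closure_mono hU)
  equation x hx := hu.equation x (hU hx)
  boundary _ _ := rfl

theorem le_of_eqOn_frontier (hu : IsDirichletSolution Ω φ u) (hv : IsDirichletSolution Ω φ v)
    (hΩ : IsOpen Ω) (hΩb : Bornology.IsBounded Ω) {x : Plane} (hx : x ∈ closure Ω) :
    u x ≤ v x := by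
  by_cases h : x ∈ Ω
  · refine sub_nonpos.1 (sub_le_of_frontier_sub_le hΩ hΩb hu.contDiffOn hv.contDiffOn
      hu.continuousOn hv.continuousOn hu.equation hv.equation (fun y hy => ?_) h)
    rw [hu.boundary y hy, hv.boundary y hy, sub_self]
  · have hx' : x ∈ frontier Ω := ⟨hx, by rwa [hΩ.interior_eq]⟩
    rw [hu.boundary x hx', hv.boundary x hx']

end IsDirichletSolution

namespace IsBowlCap

variable {c : Plane} {R : ℝ} {b : Plane → ℝ}

theorem nonpos (hb : IsBowlCap c R b) {x : Plane} (hx : x ∈ ball c R) : b x ≤ 0 :=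
  hb.isSolution.le_of_frontier_le isOpen_ball isBounded_ball (fun _ _ => le_rfl) hx

/-- By symmetry `b` is constant on the circle through `x`; the maximum principle inside that circle
applies at `c`. -/
theorem center_le (hb : IsBowlCap c R b) {x : Plane} (hx : x ∈ ball c R) : b c ≤ b x := by
  obtain ⟨f, hf⟩ := hb.radial
  rcases eq_or_ne x c with rfl | hxc
  · exact le_rfl
  have hpos : 0 < dist x c := dist_pos.2 hxc
  have hlt : dist x c < R := hx
  refine (hb.isSolution.mono (ball_subset_ball hlt.le)).le_of_frontier_le isOpen_ball
    isBounded_ball (fun y hy => ?_) (mem_ball_self hpos)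
  have hy' : dist y c = dist x c := frontier_ball_subset_sphere hy
  rw [hf y (by rw [mem_closedBall, hy']; exact hlt.le), hf x (ball_subset_closedBall hx), hy']

/-- On `frontier Ω` the bowl is nonpositive, so `b - u ≤ -m` there, and comparison extends this to
`Ω`. -/
theorem add_le {Ω : Set Plane} {φ u : Plane → ℝ} (hb : IsBowlCap c R b) (hΩ : IsOpen Ω)
    (hΩb : Bornology.IsBounded Ω) (hΩR : closure Ω ⊆ ball c R) (hu : IsDirichletSolution Ω φ u)
    {m : ℝ} (hm : ∀ x ∈ frontier Ω, m ≤ φ x) {x : Plane} (hx : x ∈ Ω) : b c + m ≤ u x := by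
  have hsub : Ω ⊆ ball c R := subset_closure.trans hΩR
  have hb' := hb.isSolution.mono hsub
  have h := sub_le_of_frontier_sub_le hΩ hΩb hb'.contDiffOn hu.contDiffOn hb'.continuousOn
    hu.continuousOn hb'.equation hu.equation (k := -m) (fun y hy => by
      have h1 := hb.nonpos (hΩR (frontier_subset_closure hy))
      have h2 := hm y hy
      rw [hu.boundary y hy]
      linarith) hx
  have := hb.center_le (hsub hx)
  linarith

end IsBowlCap

theorem proposition3p5
    (Ω : Set Plane) (hΩ_open : IsOpen Ω) (hΩ_conn : IsConnected Ω)
    (hΩ_bdd : Bornology.IsBounded Ω)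
    (φ : Plane → ℝ) (hφ : ContinuousOn φ (frontier Ω)) :
    -- uniqueness
    (∀ u v : Plane → ℝ, IsDirichletSolution Ω φ u → IsDirichletSolution Ω φ v →
      EqOn u v (closure Ω)) ∧
    -- height estimates
    (∃ C₁ M : ℝ, IsGreatest (φ '' frontier Ω) M ∧
      ∀ u : Plane → ℝ, IsDirichletSolution Ω φ u → ∀ x ∈ Ω, C₁ ≤ u x ∧ u x ≤ M) ∧
    -- the lower bound given by a bowl soliton
    (∃ m : ℝ, IsLeast (φ '' frontier Ω) m ∧
      ∀ (c : Plane) (R : ℝ) (b : Plane → ℝ), closure Ω ⊆ ball c R → IsBowlCap c R b →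
        ∀ u : Plane → ℝ, IsDirichletSolution Ω φ u → ∀ x ∈ Ω, b c + m ≤ u x) ∧
    -- gradient estimate; `G` is the continuous extension of `Du` to the closure of `Ω`
    (∀ u : Plane → ℝ, IsDirichletSolution Ω φ u →
      ∀ G : Plane → Plane, ContinuousOn G (closure Ω) → (∀ x ∈ Ω, G x = gradient u x) →
        ∃ M : ℝ, IsLUB ((fun x => ‖gradient u x‖) '' Ω) M ∧
          IsGreatest ((fun x => ‖G x‖) '' frontier Ω) M) := by
  have hfne : (frontier Ω).Nonempty := frontier_nonempty_of_isBounded hΩ_conn.nonempty hΩ_bdd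
  have hfc : IsCompact (frontier Ω) := hΩ_bdd.isCompact_closure.of_isClosed_subset
    isClosed_frontier frontier_subset_closure
  obtain ⟨M, hM⟩ := (hfc.image_of_continuousOn hφ).exists_isGreatest (hfne.image φ)
  obtain ⟨m, hm⟩ := (hfc.image_of_continuousOn hφ).exists_isLeast (hfne.image φ)
  have hmφ : ∀ x ∈ frontier Ω, m ≤ φ x := fun x hx => hm.2 (mem_image_of_mem φ hx)
  obtain ⟨r, hr⟩ := hfc.isBounded.exists_norm_le
  refine ⟨fun u v hu hv x hx => le_antisymm (hu.le_of_eqOn_frontier hv hΩ_open hΩ_bdd hx)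
      (hv.le_of_eqOn_frontier hu hΩ_open hΩ_bdd hx),
    ⟨m - 1 / 2 * r ^ 2, M, hM, fun u hu x hx => ⟨hu.sub_le hΩ_open hΩ_bdd hr hmφ hx,
      hu.le_of_frontier_le hΩ_open hΩ_bdd (fun y hy => hM.2 (mem_image_of_mem φ hy)) hx⟩⟩,
    ⟨m, hm, fun c R b hΩR hb u hu x hx => hb.add_le hΩ_open hΩ_bdd hΩR hu hmφ hx⟩,
    fun u hu G hGc hG => ?_⟩
  obtain ⟨L, hL⟩ := (hfc.image_of_continuousOn
    (hGc.norm.mono frontier_subset_closure)).exists_isGreatest (hfne.image _)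
  obtain ⟨z, hz, hzL⟩ := hL.1
  refine ⟨L, ⟨?_, fun B hB => ?_⟩, hL⟩
  · rintro _ ⟨x, hx, rfl⟩
    exact norm_gradient_le_of_frontier hΩ_open hΩ_bdd hu.contDiffOn hu.equation hGc hG
      (hzL ▸ norm_nonneg (G z)) (fun y hy => hL.2 (mem_image_of_mem _ hy)) hx
  -- The boundary maximum is a limit of interior gradients, so it cannot exceed an upper bound for
  -- them.
  · rw [← hzL]
    refine le_on_closure (s := Ω) (f := fun y => ‖G y‖) (g := fun _ => B) (fun y hy => ?_)
      hGc.norm continuousOn_const (frontier_subset_closure hz)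
    rw [hG y hy]
    exact hB (mem_image_of_mem _ hy)
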